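/- Let $p$ be a prime, let $b>0$ and $\sigma>0$ be real, and let $m\in\mathbb N_0$. Write $|\cdot|$ for the $p$-adic absolute value on $\mathbb Q_p$ and let $G=\mathbb Q_p/\mathbb Z_p$, with $|[x]|=|x|$ if $[x]\neq 0$ and $|[0]|=0$. Each $x\in\mathbb Q_p$ has a unique expansion $x=\sum_{k\in\mathbb Z}a_x(k)p^k$ with digits $a_x(k)\in\{0,\dots,p-1\}$. Define $$\Gamma_m\colon G\to\mathbb Q_p,\qquad \Gamma_m([x])=\sum_{k<m}a_{p^mx}(k)\,p^k ,$$ which depends only on the class $[x]$. Let $X_0=0$ almost surely, and let $X_1,X_2,\dots$ be independent $G$-valued random variables with the common law that gives the circle $\{g\in G: |g|=p^i\}$ probability $(p^b-1)/p^{ib}$ for each $i\ge 1$ and is uniform on each of these circles. Put $S_n=X_0+X_1+\dots+X_n$, $$\alpha=\frac{p}{p-1}\cdot\frac{p^{b+1}-1}{p^{b+1}},\qquad \tau_m=\frac{\alpha}{\sigma p^{mb}},\qquad \tilde Y^m_t=\Gamma_m\big(S_{\lfloor t/\tau_m\rfloor}\big)\quad(t\ge 0).$$ Let $D([0,\infty)\colon\mathbb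 Q_p)$ be the set of càdlàg paths $\omega\colon[0,\infty)\to\mathbb Q_p$, with the $\sigma$-algebra generated by the simple cylinder sets $\{\omega:\omega(0)\in U_0,\ \omega(t_1)\in U_1,\dots,\omega(t_k)\in U_k\}$, where $t_1<\dots<t_k$ are in $[0,\infty)$ and the $U_i$ are Borel subsets of $\mathbb Q_p$, and let $Y_t(\omega)=\omega(t)$. Then there is a probability measure $P^m$ on $D([0,\infty)\colon\mathbb Q_p)$ for which the process $(Y_t)_{t\ge0}$ has the same finite dimensional distributions as $(\tilde Y^m_t)_{t\ge 0}$. Every such $P^m$ is concentrated on the set of paths $\omega$ that take values in $\Gamma_m(G)$ and that are, for every integer $n\ge1$, constant on the interval $[(n-1)\tau_m,n\tau_m)$; that is, the complement of this set of paths is a $P^m$-null set. -/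

import Mathlib

open scoped NNReal ENNReal Topology

noncomputable section

namespace PadicWalk

/-! ### Path spaces -/

/-- Right continuous paths on `[0, ∞)` with left limits. (At `t = 0` the left-limit condition is
void, since `𝓝[<] (0 : ℝ≥0) = ⊥`.) -/
def IsCadlag {S : Type*} [TopologicalSpace S] (ω : ℝ≥0 → S) : Prop :=
  ∀ t : ℝ≥0, ContinuousWithinAt ω (Set.Ici t) t ∧ ∃ l : S, Filter.Tendsto ω (𝓝[<] t) (𝓝 l)

/-- The set `D([0, ∞) : S)` of càdlàg paths. -/
def SkorohodSpace (S : Type*) [TopologicalSpace S] : Type _ :=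
  {ω : ℝ≥0 → S // IsCadlag ω}

/-- The coordinate process `Y_t(ω) = ω(t)`. -/
def coord (S : Type*) [TopologicalSpace S] (t : ℝ≥0) (ω : SkorohodSpace S) : S :=
  ω.1 t

/-- A history `((0, U₀), (t₁, U₁), …, (t_k, U_k))`: a strictly increasing epoch `t₁ < ⋯ < t_k` and
a route of Borel sets `U₀, …, U_k`. -/
structure History (S : Type*) [TopologicalSpace S] where
  length : ℕ
  epoch : Fin length → ℝ≥0
  epoch_strictMono : StrictMono epoch
  route : Fin (length + 1) → Set S
  route_borel : ∀ i, @MeasurableSet S (borel S) (route i)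

/-- The times `0, t₁, …, t_k` of a history. -/
def History.time {S : Type*} [TopologicalSpace S] (h : History S) : Fin (h.length + 1) → ℝ≥0 :=
  Fin.cons 0 h.epoch

/-- The event that the process `Z` follows the history `h`. For the coordinate process these
are the simple cylinder sets of the path space. -/
def History.event {S : Type*} [TopologicalSpace S] (h : History S) {Ω : Type*}
    (Z : ℝ≥0 → Ω → S) : Set Ω :=
  {ω | ∀ i, Z (h.time i) ω ∈ h.route i}

/-- The σ-algebra of cylinder sets, generated by the simple cylinder sets. -/
instance (S : Type*) [TopologicalSpace S] : MeasurableSpace (SkorohodSpace S) :=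
  MeasurableSpace.generateFrom {A | ∃ h : History S, A = h.event (coord S)}

/-- `(D([0, ∞) : S), P, Y)` is a model for the process `Z` on `(Ω, μ)`: it has the same finite
dimensional distributions. -/
def IsModel {S : Type*} [TopologicalSpace S] {Ω : Type*} [MeasurableSpace Ω]
    (μ : MeasureTheory.Measure Ω) (Z : ℝ≥0 → Ω → S)
    (P : MeasureTheory.Measure (SkorohodSpace S)) : Prop :=
  ∀ h : History S, P (h.event (coord S)) = μ (h.event Z)

/-! ### The state spaces -/

variable (p : ℕ) [Fact p.Prime]

/-- The subgroup `p^m ℤ_p` of `ℚ_p`. -/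
def ballSubgroup (m : ℕ) : AddSubgroup ℚ_[p] where
  carrier := {x | ‖x‖ ≤ (p : ℝ) ^ (-(m : ℤ))}
  zero_mem' := by
    simp only [Set.mem_ofPred_eq, norm_zero]
    positivity
  add_mem' := fun {x y} hx hy => (Padic.nonarchimedean x y).trans (max_le hx hy)
  neg_mem' := fun {x} hx => by simpa using hx

/-- The group `G_m = ℚ_p / p^m ℤ_p`. -/
def Gm (m : ℕ) : Type :=
  ℚ_[p] ⧸ ballSubgroup p m

instance (m : ℕ) : AddCommGroup (Gm p m) :=
  inferInstanceAs (AddCommGroup (ℚ_[p] ⧸ ballSubgroup p m))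

/-- All subsets of the discrete group `G_m` are measurable. -/
instance (m : ℕ) : MeasurableSpace (Gm p m) := ⊤

instance (m : ℕ) : DiscreteMeasurableSpace (Gm p m) := ⟨fun _ => trivial⟩

/-- The quotient map `[·]_m : ℚ_p → G_m`. -/
def toGm (m : ℕ) : ℚ_[p] →+ Gm p m :=
  QuotientAddGroup.mk' (ballSubgroup p m)

theorem toGm_surjective (m : ℕ) : Function.Surjective (toGm p m) :=
  QuotientAddGroup.mk'_surjective _

theorem toGm_eq_iff (m : ℕ) (x y : ℚ_[p]) :
    toGm p m x = toGm p m y ↔ ‖x - y‖ ≤ (p : ℝ) ^ (-(m : ℤ)) := by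
  rw [← sub_eq_zero, ← map_sub]
  exact QuotientAddGroup.eq_zero_iff _

theorem norm_eq_of_toGm_eq {m : ℕ} {x y : ℚ_[p]} (h : toGm p m x = toGm p m y)
    (hx : toGm p m x ≠ 0) : ‖x‖ = ‖y‖ := by
  have h1 : ‖x - y‖ ≤ (p : ℝ) ^ (-(m : ℤ)) := (toGm_eq_iff p m x y).1 h
  have h2 : (p : ℝ) ^ (-(m : ℤ)) < ‖x‖ := by
    by_contra hc
    exact hx (by simpa using (toGm_eq_iff p m x 0).2 (by simpa using hc))
  have h3 := Padic.nonarchimedean (x - y) y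
  have h4 := Padic.nonarchimedean (y - x) x
  rw [sub_add_cancel] at h3 h4
  rw [norm_sub_rev y x, max_eq_right (h1.trans h2.le)] at h4
  rcases le_max_iff.1 h3 with h | h
  · exact absurd (h.trans h1) (not_le.2 h2)
  · exact le_antisymm h h4

open scoped Classical in
/-- The absolute value on `G_m`: `|[x]_m|_m` is `|x|` if `[x]_m ≠ 0`, and `0` otherwise. -/
def absGm (m : ℕ) : Gm p m → ℝ :=
  Quotient.lift (fun x : ℚ_[p] => if toGm p m x = 0 then 0 else ‖x‖) (by
    intro x y hxy
    have h : toGm p m x = toGm p m y := Quotient.sound hxy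
    by_cases hx : toGm p m x = 0
    · simp [hx, ← h]
    · simp only [← h, hx, if_false]
      exact norm_eq_of_toGm_eq p h hx)

open scoped Classical in
theorem absGm_toGm (m : ℕ) (x : ℚ_[p]) :
    absGm p m (toGm p m x) = if toGm p m x = 0 then 0 else ‖x‖ :=
  rfl

/-- The group `G = G_0 = ℚ_p / ℤ_p`. -/
abbrev G : Type := Gm p 0

/-- The isomorphism `α_m : G → G_m`, `x + ℤ_p ↦ p^m x + p^m ℤ_p`. -/
def alphaMap (m : ℕ) : G p →+ Gm p m :=
  QuotientAddGroup.map (ballSubgroup p 0) (ballSubgroup p m)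
    (AddMonoidHom.mulLeft ((p : ℚ_[p]) ^ m)) (by
      intro x hx
      change ‖x‖ ≤ (p : ℝ) ^ (-((0 : ℕ) : ℤ)) at hx
      change ‖(p : ℚ_[p]) ^ m * x‖ ≤ (p : ℝ) ^ (-(m : ℤ))
      rw [norm_mul, Padic.norm_p_pow]
      have : (0 : ℝ) ≤ (p : ℝ) ^ (-(m : ℤ)) := by positivity
      exact mul_le_of_le_one_right this (by simpa using hx))

/-! ### Digits and the spatial embeddings -/

theorem exists_digits_padicInt (y : ℤ_[p]) : ∃ d : ℕ → ℕ, (∀ i, d i < p) ∧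
    HasSum (fun i : ℕ => (d i : ℚ_[p]) * (p : ℚ_[p]) ^ i) (y : ℚ_[p]) := by
  have hp : 1 < p := (Fact.out : p.Prime).one_lt
  have key : ∀ i, ∃ e, y.appr (i + 1) - y.appr i = p ^ i * e := fun i =>
    PadicInt.dvd_appr_sub_appr y i (i + 1) (Nat.le_succ i)
  choose d hd using key
  have hmono : ∀ i, y.appr i ≤ y.appr (i + 1) := fun i => PadicInt.appr_mono y (Nat.le_succ i)
  have hstep : ∀ i, y.appr (i + 1) = y.appr i + p ^ i * d i := fun i => by
    have := hd i
    have := hmono i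
    omega
  have hsum : ∀ n, ∑ i ∈ Finset.range n, (d i : ℚ_[p]) * (p : ℚ_[p]) ^ i = (y.appr n : ℚ_[p]) := by
    intro n
    induction n with
    | zero => simp [PadicInt.appr]
    | succ n ih =>
      rw [Finset.sum_range_succ, ih, hstep n]
      push_cast
      ring
  have hpow : Filter.Tendsto (fun n : ℕ => (p : ℝ) ^ (-(n : ℤ))) Filter.atTop (𝓝 0) := by
    have h1 : (p : ℝ)⁻¹ < 1 := inv_lt_one_of_one_lt₀ (by exact_mod_cast hp)
    have h2 := tendsto_pow_atTop_nhds_zero_of_lt_one (by positivity) h1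
    refine h2.congr fun n => ?_
    rw [zpow_neg, zpow_natCast, inv_pow]
  have hlim : Filter.Tendsto (fun n => (y.appr n : ℚ_[p])) Filter.atTop (𝓝 (y : ℚ_[p])) := by
    rw [tendsto_iff_norm_sub_tendsto_zero]
    refine squeeze_zero (fun _ => norm_nonneg _) (fun n => ?_) hpow
    have h := (PadicInt.norm_le_pow_iff_mem_span_pow (y - (y.appr n : ℤ_[p])) n).2 (PadicInt.appr_spec n y)
    rw [norm_sub_rev]
    simpa [PadicInt.norm_def] using h
  have hsummable : Summable (fun i : ℕ => (d i : ℚ_[p]) * (p : ℚ_[p]) ^ i) := by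
    refine NonarchimedeanAddGroup.summable_of_tendsto_cofinite_zero ?_
    rw [Nat.cofinite_eq_atTop, tendsto_zero_iff_norm_tendsto_zero]
    refine squeeze_zero (fun _ => norm_nonneg _) (fun n => ?_) hpow
    rw [norm_mul, Padic.norm_p_pow]
    refine mul_le_of_le_one_left (by positivity) ?_
    exact_mod_cast Padic.norm_int_le_one (p := p) (d n : ℤ)
  refine ⟨d, fun i => ?_, ?_⟩
  · by_contra hc
    have h1 := PadicInt.appr_lt y (i + 1)
    have h2 := hstep i
    have h3 : p ^ i * p ≤ p ^ i * d i := Nat.mul_le_mul_left _ (not_lt.1 hc)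
    rw [pow_succ] at h1
    omega
  · have h1 := hsummable.hasSum.tendsto_sum_nat
    simp only [hsum] at h1
    rw [← tendsto_nhds_unique h1 hlim]
    exact hsummable.hasSum

theorem exists_digits (x : ℚ_[p]) : ∃ a : ℤ → ℕ, (∀ k, a k < p) ∧
    HasSum (fun k : ℤ => (a k : ℚ_[p]) * (p : ℚ_[p]) ^ k) x := by
  have hp0 : (p : ℚ_[p]) ≠ 0 := by exact_mod_cast (Fact.out : p.Prime).ne_zero
  have hp : (1 : ℝ) < p := by exact_mod_cast (Fact.out : p.Prime).one_lt
  obtain ⟨N, hN⟩ := pow_unbounded_of_one_lt ‖x‖ hp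
  have hy : ‖x * (p : ℚ_[p]) ^ N‖ ≤ 1 := by
    rw [norm_mul, Padic.norm_p_pow, zpow_neg, zpow_natCast, ← div_eq_mul_inv]
    exact (div_le_one (by positivity)).2 hN.le
  obtain ⟨d, hd, hs⟩ := exists_digits_padicInt p ⟨_, hy⟩
  refine ⟨fun k => if -(N : ℤ) ≤ k then d (k + N).toNat else 0, fun k => ?_, ?_⟩
  · dsimp only
    split_ifs
    · exact hd _
    · exact (Fact.out : p.Prime).pos
  · have hinj : Function.Injective (fun i : ℕ => (i : ℤ) - N) := fun i j h => by
      simpa using h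
    refine (hinj.hasSum_iff ?_).1 ?_
    · intro k hk
      have : ¬ -(N : ℤ) ≤ k := fun h => hk ⟨(k + N).toNat, by
        dsimp only
        omega⟩
      simp [this]
    · have h2 := hs.mul_right ((p : ℚ_[p]) ^ (-(N : ℤ)))
      convert! h2 using 1
      · funext i
        simp [zpow_sub₀ hp0, mul_assoc, div_eq_mul_inv]
      · simp [hp0]

/-- The digits `a_x : ℤ → {0, …, p - 1}` of the (unique) expansion `x = ∑ a_x(k) p^k`. -/
def digit (x : ℚ_[p]) : ℤ → ℕ :=
  (exists_digits p x).choose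

/-- The injection `j_m : G_m → ℚ_p`, which truncates the expansion of a representative: only the
digits at places `k < m` are kept, and these do not depend on the representative. -/
def jMap (m : ℕ) (z : Gm p m) : ℚ_[p] :=
  ∑' k : ℤ, if k < (m : ℤ) then (digit p (Quotient.out z) k : ℚ_[p]) * (p : ℚ_[p]) ^ k else 0

/-- The spatial embedding `Γ_m = j_m ∘ α_m : G → ℚ_p`. -/
def Gamma (m : ℕ) (g : G p) : ℚ_[p] :=
  jMap p m (alphaMap p m g)

/-! ### The primitive process -/

/-- The circle of radius `p^i` around `0` in `G`. -/
def circle (i : ℕ) : Set (G p) :=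
  {g | absGm p 0 g = (p : ℝ) ^ i}

/-- The law of the generator: the circle of radius `p^i`, `i ≥ 1`, has probability
`(p^b - 1) / p^(i b)`, and the law is uniform on each circle. -/
def generatorLaw (b : ℝ) : MeasureTheory.Measure (G p) :=
  MeasureTheory.Measure.sum fun i : ℕ =>
    ENNReal.ofReal (((p : ℝ) ^ b - 1) / (p : ℝ) ^ (((i + 1 : ℕ) : ℝ) * b)) •
      ProbabilityTheory.uniformOn (circle p (i + 1))

theorem circle_finite (i : ℕ) : (circle p i).Finite := by
  let _ : TopologicalSpace (Gm p 0) := ⊥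
  have : DiscreteTopology (Gm p 0) := ⟨rfl⟩
  have hc : Continuous (toGm p 0) := by
    refine IsLocallyConstant.continuous ((IsLocallyConstant.iff_exists_open _).2 fun x => ?_)
    refine ⟨Metric.ball x 1, Metric.isOpen_ball, Metric.mem_ball_self one_pos, fun y hy => ?_⟩
    rw [toGm_eq_iff]
    simpa using (mem_ball_iff_norm.1 hy).le
  have hK := (isCompact_closedBall (0 : ℚ_[p]) ((p : ℝ) ^ i)).image hc
  refine (hK.finite_of_discrete).subset ?_
  intro g hg
  obtain ⟨x, rfl⟩ := toGm_surjective p 0 g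
  have hg' : absGm p 0 (toGm p 0 x) = (p : ℝ) ^ i := hg
  rw [absGm_toGm] at hg'
  split_ifs at hg' with h0
  · have : (0 : ℝ) < (p : ℝ) ^ i := by
      have : (0 : ℝ) < p := by exact_mod_cast (Fact.out : p.Prime).pos
      positivity
    exact absurd hg' this.ne
  · exact ⟨x, by simpa using hg'.le, rfl⟩

theorem circle_nonempty (i : ℕ) : (circle p (i + 1)).Nonempty := by
  have hp : (1 : ℝ) < p := by exact_mod_cast (Fact.out : p.Prime).one_lt
  have hn : ‖(p : ℚ_[p]) ^ (-((i + 1 : ℕ) : ℤ))‖ = (p : ℝ) ^ (i + 1) := by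
    rw [Padic.norm_p_zpow, neg_neg, zpow_natCast]
  refine ⟨toGm p 0 ((p : ℚ_[p]) ^ (-((i + 1 : ℕ) : ℤ))), ?_⟩
  change absGm p 0 _ = _
  rw [absGm_toGm, if_neg, hn]
  intro h
  have h1 := (toGm_eq_iff p 0 ((p : ℚ_[p]) ^ (-((i + 1 : ℕ) : ℤ))) 0).1 (by rw [h, map_zero])
  rw [sub_zero, hn] at h1
  exact absurd (one_lt_pow₀ hp (Nat.succ_ne_zero i)) (not_lt.2 (by simpa using h1))

theorem isProbabilityMeasure_generatorLaw {b : ℝ} (hb : 0 < b) :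
    MeasureTheory.IsProbabilityMeasure (generatorLaw p b) := by
  have hp : (1 : ℝ) < p := by exact_mod_cast (Fact.out : p.Prime).one_lt
  have hq : 1 < (p : ℝ) ^ b := Real.one_lt_rpow hp hb
  have hu : ∀ i, ProbabilityTheory.uniformOn (circle p (i + 1)) Set.univ = 1 := fun i =>
    (ProbabilityTheory.isProbabilityMeasure_uniformOn (circle_finite p _)
      (circle_nonempty p i)).measure_univ
  have hterm : ∀ i : ℕ, ((p : ℝ) ^ b - 1) / (p : ℝ) ^ (((i + 1 : ℕ) : ℝ) * b) =
      (((p : ℝ) ^ b - 1) * ((p : ℝ) ^ b)⁻¹) * (((p : ℝ) ^ b)⁻¹) ^ i := fun i => by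
    rw [mul_comm (((i + 1 : ℕ) : ℝ)) b, Real.rpow_mul (by positivity), Real.rpow_natCast,
      div_eq_mul_inv, ← inv_pow, pow_succ]
    ring
  have hgeo : HasSum (fun i : ℕ => ((p : ℝ) ^ b - 1) / (p : ℝ) ^ (((i + 1 : ℕ) : ℝ) * b)) 1 := by
    simp only [hterm]
    have h := (hasSum_geometric_of_lt_one (r := ((p : ℝ) ^ b)⁻¹) (by positivity)
      (inv_lt_one_of_one_lt₀ hq)).mul_left (((p : ℝ) ^ b - 1) * ((p : ℝ) ^ b)⁻¹)
    convert! h using 1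
    have h1 : (p : ℝ) ^ b - 1 ≠ 0 := by linarith
    have h2 : (p : ℝ) ^ b ≠ 0 := by linarith
    field_simp
  refine ⟨?_⟩
  rw [generatorLaw, MeasureTheory.Measure.sum_apply _ MeasurableSet.univ]
  simp only [MeasureTheory.Measure.smul_apply, hu, smul_eq_mul, mul_one]
  rw [← ENNReal.ofReal_tsum_of_nonneg (fun i => ?_) hgeo.summable, hgeo.tsum_eq, ENNReal.ofReal_one]
  exact div_nonneg (by linarith) (by positivity)

/-- The laws of the summands `X₀, X₁, X₂, …`: `X₀ = 0` almost surely, and every other one is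
distributed as the generator. -/
def summandLaw (b : ℝ) : ℕ → MeasureTheory.Measure (G p)
  | 0 => MeasureTheory.Measure.dirac 0
  | _ + 1 => generatorLaw p b

/-- So the infinite product below is a product of probability measures. -/
theorem isProbabilityMeasure_summandLaw {b : ℝ} (hb : 0 < b) :
    ∀ i, MeasureTheory.IsProbabilityMeasure (summandLaw p b i)
  | 0 => MeasureTheory.Measure.dirac.isProbabilityMeasure
  | _ + 1 => isProbabilityMeasure_generatorLaw p hb

/-- The joint law of the independent summands `X₀, X₁, X₂, …`. -/
def summandsLaw (b : ℝ) : MeasureTheory.Measure (ℕ → G p) :=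
  MeasureTheory.Measure.infinitePi (summandLaw p b)

/-- The primitive process `S_n = X₀ + X₁ + ⋯ + X_n`. -/
def primitive (n : ℕ) (x : ℕ → G p) : G p :=
  ∑ i ∈ Finset.range (n + 1), x i

/-! ### The embedded processes -/

/-- The constant `α = (p / (p - 1)) ((p^(b + 1) - 1) / p^(b + 1))`. -/
def alphaConst (b : ℝ) : ℝ :=
  (p : ℝ) / ((p : ℝ) - 1) * (((p : ℝ) ^ (b + 1) - 1) / (p : ℝ) ^ (b + 1))

/-- The time scale `τ_m = α / (σ p^(m b))`. -/
def timeStep (b σ : ℝ) (m : ℕ) : ℝ :=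
  alphaConst p b / (σ * (p : ℝ) ^ ((m : ℝ) * b))

/-- The embedded process `Y^m_t = Γ_m (S_⌊t / τ_m⌋)`. -/
def embedded (b σ : ℝ) (m : ℕ) (t : ℝ≥0) (x : ℕ → G p) : ℚ_[p] :=
  Gamma p m (primitive p ⌊(t : ℝ) / timeStep p b σ m⌋₊ x)

/-- The càdlàg paths that take values in the grid `Γ_m(G)` and are constant on each of the
intervals `[(n - 1) τ_m, n τ_m)`, `n ≥ 1`. -/
def gridPaths (b σ : ℝ) (m : ℕ) : Set (SkorohodSpace ℚ_[p]) :=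
  {ω | (∀ t : ℝ≥0, ω.1 t ∈ Set.range (Gamma p m)) ∧
    ∀ n : ℕ, 1 ≤ n → ∀ s t : ℝ≥0,
      (s : ℝ) ∈ Set.Ico (((n : ℝ) - 1) * timeStep p b σ m) ((n : ℝ) * timeStep p b σ m) →
      (t : ℝ) ∈ Set.Ico (((n : ℝ) - 1) * timeStep p b σ m) ((n : ℝ) * timeStep p b σ m) →
      ω.1 s = ω.1 t}

end PadicWalk

end

namespace PadicWalk

open MeasureTheory Filter Set

open scoped NNReal ENNReal Topology

/-! ### Step paths -/

/-! Existence: for each sample the embedded process is a sequence composed with `⌊t / τ⌋`, hence a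
càdlàg step path. Sending a sample to its path is measurable, because `G` is countable and discrete,
and the push-forward of the law of the summands is a model.

Concentration: a model is known only through finitely many times at once, while the grid condition
concerns uncountably many. The values of the process lie in the countable set `C = Γ_m(G)`. So at
one fixed time the coordinate lies in `C` almost surely (`IsModel.ae_coord_mem`), and at two fixed
times of the same step the coordinates agree almost surely (`IsModel.ae_coord_eq`). Imposing this on
a countable dense set of times costs one null set, and right continuity carries the conclusion to
all times (`IsCadlag.eq_of_dense`). -/

theorem natFloor_div_eq_of_mem_Ico {τ : ℝ} (hτ : 0 < τ) {k : ℕ} {s : ℝ}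
    (hs : s ∈ Ico (k * τ) ((k + 1) * τ)) : ⌊s / τ⌋₊ = k := by
  have h0 : 0 ≤ s / τ := div_nonneg ((by positivity : (0 : ℝ) ≤ k * τ).trans hs.1) hτ.le
  exact (Nat.floor_eq_iff h0).2 ⟨(le_div_iff₀ hτ).2 hs.1, (div_lt_iff₀ hτ).2 hs.2⟩

theorem mem_Ico_natFloor_div {τ : ℝ} (hτ : 0 < τ) {s : ℝ} (hs : 0 ≤ s) :
    s ∈ Ico (⌊s / τ⌋₊ * τ) ((⌊s / τ⌋₊ + 1) * τ) :=
  ⟨(le_div_iff₀ hτ).1 (Nat.floor_le (div_nonneg hs hτ.le)),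
    (div_lt_iff₀ hτ).1 (Nat.lt_floor_add_one _)⟩

theorem isCadlag_comp_natFloor_div {S : Type*} [TopologicalSpace S] (f : ℕ → S) {τ : ℝ}
    (hτ : 0 < τ) : IsCadlag fun t : ℝ≥0 => f ⌊(t : ℝ) / τ⌋₊ := by
  intro t
  constructor
  · refine tendsto_const_nhds.congr' (f₁ := fun _ => f ⌊(t : ℝ) / τ⌋₊) ?_
    have ht := mem_Ico_natFloor_div hτ t.2
    have hlt : ∀ᶠ s : ℝ≥0 in 𝓝[≥] t, (s : ℝ) < (⌊(t : ℝ) / τ⌋₊ + 1) * τ :=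
      nhdsWithin_le_nhds (NNReal.continuous_coe.continuousAt.eventually_lt continuousAt_const ht.2)
    filter_upwards [hlt, self_mem_nhdsWithin] with s hs hts
    exact congrArg f
      (natFloor_div_eq_of_mem_Ico hτ ⟨ht.1.trans (NNReal.coe_le_coe.2 hts), hs⟩).symm
  · rcases eq_or_ne t 0 with rfl | h0
    · refine ⟨f 0, ?_⟩
      have : 𝓝[<] (0 : ℝ≥0) = ⊥ := by
        rw [show Iio (0 : ℝ≥0) = ∅ from Iio_bot, nhdsWithin_empty]
      rw [this]
      exact tendsto_bot
    · have hpos : 0 < (t : ℝ) / τ := div_pos (NNReal.coe_pos.2 (pos_iff_ne_zero.2 h0)) hτ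
      -- The ceiling, not the floor, finds the step to the left of `t`: with `⌈t / τ⌉ = k + 1` one
      -- has `kτ < t ≤ (k + 1)τ`, so at a jump time the left limit is the value before the jump.
      obtain ⟨k, hk⟩ := Nat.exists_eq_succ_of_ne_zero (Nat.ceil_pos.2 hpos).ne'
      have h1 : (t : ℝ) ≤ (k + 1) * τ := by
        have := Nat.le_ceil ((t : ℝ) / τ)
        rw [hk, div_le_iff₀ hτ] at this
        exact_mod_cast this
      have h2 : k * τ < (t : ℝ) := by
        have := Nat.ceil_lt_add_one hpos.le
        rw [hk, Nat.cast_succ, add_lt_add_iff_right, lt_div_iff₀ hτ] at this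
        exact this
      refine ⟨f k, tendsto_const_nhds.congr' ?_⟩
      have hlt : ∀ᶠ s : ℝ≥0 in 𝓝[<] t, k * τ < (s : ℝ) :=
        nhdsWithin_le_nhds
          (continuousAt_const.eventually_lt NNReal.continuous_coe.continuousAt h2)
      filter_upwards [hlt, self_mem_nhdsWithin] with s hs hts
      rw [natFloor_div_eq_of_mem_Ico hτ ⟨hs.le, (NNReal.coe_lt_coe.2 hts).trans_le h1⟩]

/-! ### Countability and measurability -/

variable (p : ℕ) [Fact p.Prime]

/-- `G` is the union of `{0}` and countably many finite circles. Countability makes addition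
measurable on the product `G × G`, which the partial sums need, and makes the range of `Γ_m` a
countable, hence Borel, set. -/
instance countable_G : Countable (G p) := by
  have hp : (1 : ℝ) < p := by exact_mod_cast (Fact.out : p.Prime).one_lt
  rw [← countable_univ_iff]
  refine ((countable_singleton (0 : G p)).union
    (countable_iUnion fun i => (circle_finite p i).countable)).mono fun g _ => ?_
  obtain ⟨x, rfl⟩ := toGm_surjective p 0 g
  rw [mem_union, mem_singleton_iff, or_iff_not_imp_left]
  intro h0
  have hx : 1 < ‖x‖ := by
    by_contra hc
    exact h0 (by simpa using (toGm_eq_iff p 0 x 0).2 (by simpa using hc))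
  obtain ⟨n, hn⟩ := Padic.norm_eq_zpow_neg_valuation (norm_pos_iff.1 (one_pos.trans hx)) ▸
    (⟨-x.valuation, rfl⟩ : ∃ n : ℤ, (p : ℝ) ^ (-x.valuation) = (p : ℝ) ^ n)
  rw [hn] at hx
  have hn0 : 0 < n := (one_lt_zpow_iff_right₀ hp).1 hx
  lift n to ℕ using hn0.le
  refine mem_iUnion.2 ⟨n, ?_⟩
  change absGm p 0 _ = _
  rw [absGm_toGm, if_neg h0, hn, zpow_natCast]

theorem measurable_primitive (n : ℕ) : Measurable (primitive p n) := by
  unfold primitive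
  exact Finset.measurable_fun_sum _ fun i _ => measurable_pi_apply i

theorem timeStep_pos {b σ : ℝ} (hb : 0 < b) (hσ : 0 < σ) (m : ℕ) : 0 < timeStep p b σ m := by
  have hp : (1 : ℝ) < p := by exact_mod_cast (Fact.out : p.Prime).one_lt
  have hq : 1 < (p : ℝ) ^ (b + 1) := Real.one_lt_rpow hp (by linarith)
  have h1 : 0 < (p : ℝ) - 1 := by linarith
  have h2 : 0 < (p : ℝ) ^ (b + 1) - 1 := by linarith
  unfold timeStep alphaConst
  positivity

/-- Every subset of the discrete group `G` is measurable, so neither `U` nor `Γ_m` has to satisfy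
any regularity condition. -/
theorem measurableSet_embedded_preimage (b σ : ℝ) (m : ℕ) (t : ℝ≥0) (U : Set ℚ_[p]) :
    MeasurableSet (embedded p b σ m t ⁻¹' U) :=
  measurable_primitive p _ (MeasurableSet.of_discrete (s := Gamma p m ⁻¹' U))

theorem measurableSet_event_embedded (b σ : ℝ) (m : ℕ) (h : History ℚ_[p]) :
    MeasurableSet (h.event (embedded p b σ m)) := by
  have : h.event (embedded p b σ m) = ⋂ i, embedded p b σ m (h.time i) ⁻¹' h.route i := by
    ext
    simp [History.event]
  rw [this]
  exact MeasurableSet.iInter fun i => measurableSet_embedded_preimage p b σ m _ _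

theorem measurableSet_event_coord {S : Type*} [TopologicalSpace S] (h : History S) :
    MeasurableSet (h.event (coord S)) :=
  MeasurableSpace.measurableSet_generateFrom ⟨h, rfl⟩

/-! ### Existence of a model -/

/-- The path of the embedded process. -/
noncomputable def embeddedPath {b σ : ℝ} (hb : 0 < b) (hσ : 0 < σ) (m : ℕ) (x : ℕ → G p) :
    SkorohodSpace ℚ_[p] :=
  ⟨fun t => embedded p b σ m t x,
    isCadlag_comp_natFloor_div (fun n => Gamma p m (primitive p n x)) (timeStep_pos p hb hσ m)⟩

/-- Testing on simple cylinder sets suffices, and the preimage of such a set is by definition the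
event that the embedded process follows the same history. -/
theorem measurable_embeddedPath {b σ : ℝ} (hb : 0 < b) (hσ : 0 < σ) (m : ℕ) :
    Measurable (embeddedPath p hb hσ m) := by
  refine measurable_generateFrom ?_
  rintro _ ⟨h, rfl⟩
  exact measurableSet_event_embedded p b σ m h

theorem exists_isModel_embedded {b σ : ℝ} (hb : 0 < b) (hσ : 0 < σ) (m : ℕ) :
    ∃ P : Measure (SkorohodSpace ℚ_[p]),
      IsProbabilityMeasure P ∧ IsModel (summandsLaw p b) (embedded p b σ m) P := by
  have := isProbabilityMeasure_summandLaw p hb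
  have : IsProbabilityMeasure (summandsLaw p b) := by
    unfold summandsLaw
    infer_instance
  have hm := measurable_embeddedPath p hb hσ m
  refine ⟨(summandsLaw p b).map (embeddedPath p hb hσ m),
    Measure.isProbabilityMeasure_map hm.aemeasurable, fun h => ?_⟩
  rw [Measure.map_apply hm (measurableSet_event_coord h)]
  rfl

/-! ### Concentration on the grid paths -/

/-- The history `((0, S), (t, U))`. -/
def History.single {S : Type*} [TopologicalSpace S] (t : ℝ≥0) {U : Set S}
    (hU : MeasurableSet[borel S] U) : History S where
  length := 1
  epoch := fun _ => t
  epoch_strictMono := Subsingleton.strictMono _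
  route := ![univ, U]
  route_borel := by
    intro i
    fin_cases i
    · exact @MeasurableSet.univ _ (borel S)
    · exact hU

/-- The history `((0, S), (s, U), (t, V))`. -/
def History.pair {S : Type*} [TopologicalSpace S] {s t : ℝ≥0} (hst : s < t) {U V : Set S}
    (hU : MeasurableSet[borel S] U) (hV : MeasurableSet[borel S] V) : History S where
  length := 2
  epoch := ![s, t]
  epoch_strictMono := by
    rw [Fin.strictMono_iff_lt_succ]
    simpa using hst
  route := ![univ, U, V]
  route_borel := by
    intro i
    fin_cases i
    · exact @MeasurableSet.univ _ (borel S)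
    · exact hU
    · exact hV

section Model

variable {S : Type*} [TopologicalSpace S] {Ω : Type*}

theorem History.event_single (Z : ℝ≥0 → Ω → S) (t : ℝ≥0) {U : Set S}
    (hU : MeasurableSet[borel S] U) : (History.single t hU).event Z = {x | Z t x ∈ U} := by
  ext x
  simp [History.event, History.single, History.time, Fin.forall_fin_two]

theorem History.event_pair (Z : ℝ≥0 → Ω → S) {s t : ℝ≥0} (hst : s < t) {U V : Set S}
    (hU : MeasurableSet[borel S] U) (hV : MeasurableSet[borel S] V) :
    (History.pair hst hU hV).event Z = {x | Z s x ∈ U ∧ Z t x ∈ V} := by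
  ext x
  simp [History.event, History.pair, History.time, Fin.forall_fin_succ]

variable [MeasurableSpace Ω] {μ : Measure Ω} {Z : ℝ≥0 → Ω → S} {P : Measure (SkorohodSpace S)}

/-- The case `t = 0` is included: an epoch may itself contain time `0`, beside the initial entry,
which is left unconstrained. -/
theorem IsModel.measure_coord_mem (hP : IsModel μ Z P) (t : ℝ≥0) {U : Set S}
    (hU : MeasurableSet[borel S] U) :
    P {ω | coord S t ω ∈ U} = μ {x | Z t x ∈ U} := by
  rw [← History.event_single (coord S) t hU, ← History.event_single Z t hU]
  exact hP _

theorem IsModel.measure_coord_mem_mem (hP : IsModel μ Z P) {s t : ℝ≥0} (hst : s < t)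
    {U V : Set S} (hU : MeasurableSet[borel S] U) (hV : MeasurableSet[borel S] V) :
    P {ω | coord S s ω ∈ U ∧ coord S t ω ∈ V} = μ {x | Z s x ∈ U ∧ Z t x ∈ V} := by
  rw [← History.event_pair (coord S) hst hU hV, ← History.event_pair Z hst hU hV]
  exact hP _

theorem measurableSet_borel_of_countable [T1Space S] {C : Set S} (hC : C.Countable) :
    MeasurableSet[borel S] C := by
  borelize S
  exact hC.measurableSet

theorem IsModel.ae_coord_mem [T1Space S] (hP : IsModel μ Z P) {C : Set S} (hC : C.Countable)
    (hZ : ∀ t x, Z t x ∈ C) (t : ℝ≥0) : ∀ᵐ ω ∂P, coord S t ω ∈ C := by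
  have h := hP.measure_coord_mem t (measurableSet_borel_of_countable hC).compl
  have h0 : {x | Z t x ∈ Cᶜ} = ∅ := eq_empty_of_forall_notMem fun x hx => hx (hZ t x)
  rw [h0, measure_empty] at h
  exact h

/-- Equality of two coordinates is not a cylinder event. Countability of `C` reduces its failure to
a countable union of the null events `Y_s = a`, `Y_t ≠ a` with `a ∈ C`, up to the null event `Y_s ∉
C`. -/
theorem IsModel.ae_coord_eq_of_lt [T1Space S] (hP : IsModel μ Z P) {C : Set S}
    (hC : C.Countable) (hZ : ∀ t x, Z t x ∈ C) {s t : ℝ≥0} (hst : s < t)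
    (h : ∀ x, Z s x = Z t x) : ∀ᵐ ω ∂P, coord S s ω = coord S t ω := by
  have hne : ∀ᵐ ω ∂P, ∀ a ∈ C, ¬ (coord S s ω ∈ ({a} : Set S) ∧ coord S t ω ∈ ({a} : Set S)ᶜ) := by
    refine (ae_ball_iff hC).2 fun a _ => ?_
    have ha : MeasurableSet[borel S] ({a} : Set S) :=
      measurableSet_borel_of_countable (countable_singleton a)
    have h1 := hP.measure_coord_mem_mem hst ha ha.compl
    have h0 : {x | Z s x ∈ ({a} : Set S) ∧ Z t x ∈ ({a} : Set S)ᶜ} = ∅ :=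
      eq_empty_of_forall_notMem fun x hx => hx.2 (h x ▸ hx.1)
    rw [h0, measure_empty] at h1
    rw [ae_iff]
    simpa only [not_not] using h1
  filter_upwards [hne, hP.ae_coord_mem hC hZ s] with ω h1 h2
  by_contra hc
  exact h1 _ h2 ⟨rfl, fun h3 => hc h3.symm⟩

theorem IsModel.ae_coord_eq [T1Space S] (hP : IsModel μ Z P) {C : Set S}
    (hC : C.Countable) (hZ : ∀ t x, Z t x ∈ C) {s t : ℝ≥0}
    (h : ∀ x, Z s x = Z t x) : ∀ᵐ ω ∂P, coord S s ω = coord S t ω := by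
  rcases lt_trichotomy s t with hst | rfl | hst
  · exact hP.ae_coord_eq_of_lt hC hZ hst h
  · exact Eventually.of_forall fun _ => rfl
  · filter_upwards [hP.ae_coord_eq_of_lt hC hZ hst fun x => (h x).symm] with ω hω using hω.symm

end Model

/-- A right continuous path takes the value `c` at `t` if it does so at the points of a dense set
in an interval `(t, u)`. -/
theorem IsCadlag.eq_of_dense {S : Type*} [TopologicalSpace S] [T2Space S] {ω : ℝ≥0 → S}
    (hω : IsCadlag ω) {D : Set ℝ≥0} (hD : Dense D) {t u : ℝ≥0} (htu : t < u) {c : S}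
    (h : ∀ q ∈ D, q ∈ Ioo t u → ω q = c) : ω t = c := by
  -- Density makes `D` accumulate at `t` from the right, so the limit of `ω` at `t` along `D ∩ (t,
  -- u)` is unique. It is `ω t` by right continuity and `c` by hypothesis.
  have hmem : t ∈ closure (Ioo t u ∩ D) := by
    refine closure_minimal (hD.open_subset_closure_inter isOpen_Ioo) isClosed_closure ?_
    rw [closure_Ioo htu.ne]
    exact left_mem_Icc.2 htu.le
  have := mem_closure_iff_nhdsWithin_neBot.1 hmem
  have h1 : Tendsto ω (𝓝[Ioo t u ∩ D] t) (𝓝 (ω t)) :=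
    (hω t).1.mono_left (nhdsWithin_mono _ fun q hq => hq.1.1.le)
  refine tendsto_nhds_unique h1 (tendsto_const_nhds.congr' ?_)
  filter_upwards [self_mem_nhdsWithin] with q hq using (h q hq.2 hq.1).symm

theorem ae_mem_gridPaths {b σ : ℝ} (hb : 0 < b) (hσ : 0 < σ) (m : ℕ)
    {P : Measure (SkorohodSpace ℚ_[p])}
    (hP : IsModel (summandsLaw p b) (embedded p b σ m) P) :
    ∀ᵐ ω ∂P, ω ∈ gridPaths p b σ m := by
  have hτ := timeStep_pos p hb hσ m
  have hC : (range (Gamma p m)).Countable := countable_range _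
  have hZ : ∀ t x, embedded p b σ m t x ∈ range (Gamma p m) := fun t x => mem_range_self _
  obtain ⟨D, hDc, hD⟩ := TopologicalSpace.exists_countable_dense ℝ≥0
  have hmem : ∀ᵐ ω ∂P, ∀ q ∈ D, coord ℚ_[p] q ω ∈ range (Gamma p m) :=
    (ae_ball_iff hDc).2 fun q _ => hP.ae_coord_mem hC hZ q
  -- There are only countably many pairs from `D`, so the exceptional null sets of the pairs lying
  -- in a common step can be united.
  have heq : ∀ᵐ ω ∂P, ∀ q ∈ D, ∀ r ∈ D,
      ⌊(q : ℝ) / timeStep p b σ m⌋₊ = ⌊(r : ℝ) / timeStep p b σ m⌋₊ →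
        coord ℚ_[p] q ω = coord ℚ_[p] r ω := by
    refine (ae_ball_iff hDc).2 fun q _ => (ae_ball_iff hDc).2 fun r _ => ?_
    by_cases hqr : ⌊(q : ℝ) / timeStep p b σ m⌋₊ = ⌊(r : ℝ) / timeStep p b σ m⌋₊
    · filter_upwards [hP.ae_coord_eq hC hZ (s := q) (t := r) fun x => by
        simp only [embedded, hqr]] with ω hω _ using hω
    · exact Eventually.of_forall fun _ h => absurd h hqr
  filter_upwards [hmem, heq] with ω h1 h2
  -- The constant is the value at a point of `D` inside the step. Its membership in the range of
  -- `Γ_m` is already known, so the range need not be shown closed.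
  have key : ∀ k : ℕ, ∃ c ∈ range (Gamma p m), ∀ t : ℝ≥0,
      (t : ℝ) ∈ Ico (k * timeStep p b σ m) ((k + 1) * timeStep p b σ m) → ω.1 t = c := by
    intro k
    obtain ⟨u, hu⟩ : ∃ u : ℝ≥0, (u : ℝ) = (k + 1) * timeStep p b σ m :=
      ⟨⟨_, by positivity⟩, rfl⟩
    obtain ⟨l, hl⟩ : ∃ l : ℝ≥0, (l : ℝ) = k * timeStep p b σ m := ⟨⟨_, by positivity⟩, rfl⟩
    have hlu : l < u := by
      rw [← NNReal.coe_lt_coe, hl, hu]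
      linarith
    have hfloor : ∀ q : ℝ≥0, l ≤ q → q < u → ⌊(q : ℝ) / timeStep p b σ m⌋₊ = k := fun q hlq hqu =>
      natFloor_div_eq_of_mem_Ico hτ ⟨hl ▸ NNReal.coe_le_coe.2 hlq, hu ▸ NNReal.coe_lt_coe.2 hqu⟩
    obtain ⟨r, hrD, hr⟩ := hD.exists_between hlu
    refine ⟨ω.1 r, h1 r hrD, fun t ht => ?_⟩
    rw [← hl, ← hu] at ht
    have hlt : l ≤ t := NNReal.coe_le_coe.1 ht.1
    -- As the step is half-open on the right, all of `(t, u)` stays in it, even when `t` is its left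
    -- endpoint; right continuity is therefore enough.
    refine ω.2.eq_of_dense hD (NNReal.coe_lt_coe.1 ht.2) fun q hq hqt => h2 q hq r hrD ?_
    rw [hfloor q (hlt.trans hqt.1.le) hqt.2, hfloor r hr.1.le hr.2]
  refine ⟨fun t => ?_, fun n hn s t hs ht => ?_⟩
  · obtain ⟨c, hc, h⟩ := key ⌊(t : ℝ) / timeStep p b σ m⌋₊
    rw [h t (mem_Ico_natFloor_div hτ t.2)]
    exact hc
  · obtain ⟨k, rfl⟩ := Nat.exists_eq_add_of_le' hn
    obtain ⟨c, -, h⟩ := key k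
    simp only [Nat.cast_add, Nat.cast_one, add_sub_cancel_right] at hs ht
    rw [h s hs, h t ht]

end PadicWalk

theorem mainTheorem10 (p : ℕ) [Fact p.Prime] (b σ : ℝ) (hb : 0 < b) (hσ : 0 < σ) (m : ℕ) :
    (∃ P : MeasureTheory.Measure (PadicWalk.SkorohodSpace ℚ_[p]),
      MeasureTheory.IsProbabilityMeasure P ∧
        PadicWalk.IsModel (PadicWalk.summandsLaw p b) (PadicWalk.embedded p b σ m) P) ∧
    ∀ P : MeasureTheory.Measure (PadicWalk.SkorohodSpace ℚ_[p]),
      MeasureTheory.IsProbabilityMeasure P →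
      PadicWalk.IsModel (PadicWalk.summandsLaw p b) (PadicWalk.embedded p b σ m) P →
      ∀ᵐ ω ∂P, ω ∈ PadicWalk.gridPaths p b σ m :=
  ⟨PadicWalk.exists_isModel_embedded p hb hσ m,
    fun _ _ hP => PadicWalk.ae_mem_gridPaths p hb hσ m hP⟩
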